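/- For an integer $n\ge 2$ let $G_n$, the straight linear 2-tree on $n$ vertices, be the simple graph with vertex set $\{1,\dots,n\}$ in which distinct vertices $a,b$ are adjacent if and only if $|a-b|\le 2$, and let $m=n-2$ (the number of triangles of $G_n$). Let every edge of $G_n$ be a unit resistor, and for vertices $a,b$ let $r_m(a,b)$ be the resistance distance between $a$ and $b$, that is, the potential difference $v_a-v_b$ for any $v\in\mathbb{R}^n$ with $Lv=e_a-e_b$, where $L$ is the Laplacian matrix of $G_n$. Let $F_p$, $p\in\mathbb{Z}$, denote the Fibonacci numbers ($F_0=0$, $F_1=1$, $F_{p+2}=F_p+F_{p+1}$ for all integers $p$, so that $F_{-p}=(-1)^{p+1}F_p$) and $L_k$ the Lucas numbers ($L_0=2$, $L_1=1$, $L_{k+2}=L_k+L_{k+1}$). **Theorem.** For all integers $j\ge 1$ and $k\ge 1$ with $j+k\le n$, $$r_m(j,j+k)=\frac{\sum_{i=1}^{k}\left[F_iF_{i+2j-2}-F_{i-1}F_{i+2j-3}\right]F_{2m-2i-2j+5}}{F_{2m+2}}$$ and also $$r_m(j,j+k)=\frac{F_{m+1}^2+F_k^2F_{m-2j-k+3}^2+\frac{F_{m+1}}{5}\left[F_{m-k}\left(kL_k-F_k\right)+F_{m-k+1}\left((k-5)F_{k+1}+(2k+2)F_k\right)\right]}{F_{2m+2}}.$$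 -/

import Mathlib

namespace SimpleGraph

section Resistance

variable {V : Type*} [Fintype V] [DecidableEq V] (G : SimpleGraph V) [DecidableRel G.Adj]

/-- Every edge of the graph `G` carries a unit resistor, one unit of current enters at `i` and
one unit leaves at `j`. `v` is a vector of node potentials for this flow (Ohm's and Kirchhoff's
laws): `L(G) v = e_i - e_j`, with `L(G)` the Laplacian matrix. -/
def IsUnitCurrentPotential (i j : V) (v : V → ℝ) : Prop :=
  Matrix.mulVec (G.lapMatrix ℝ) v = Pi.single i 1 - Pi.single j 1

open Classical in
/-- The resistance distance (effective resistance) `r_G(i, j)`: the potential difference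
`v i - v j` that sends one unit of current from `i` to `j`. For a connected graph such a `v`
exists and the difference does not depend on it, see `exists_isUnitCurrentPotential` and
`resistanceDistance_eq`. (The value is `0` if there is no such `v`.) -/
noncomputable def resistanceDistance (i j : V) : ℝ :=
  if h : ∃ v : V → ℝ, G.IsUnitCurrentPotential i j v then h.choose i - h.choose j else 0

theorem resistanceDistance_eq (hG : G.Connected) {i j : V} {v : V → ℝ}
    (hv : G.IsUnitCurrentPotential i j v) : G.resistanceDistance i j = v i - v j := by
  have h : ∃ v : V → ℝ, G.IsUnitCurrentPotential i j v := ⟨v, hv⟩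
  rw [resistanceDistance, dif_pos h]
  have h0 : Matrix.mulVec (G.lapMatrix ℝ) (h.choose - v) = 0 := by
    rw [Matrix.mulVec_sub]
    exact sub_eq_zero.2 (h.choose_spec.trans hv.symm)
  have h1 := (G.lapMatrix_mulVec_eq_zero_iff_forall_reachable).1 h0 i j (hG.preconnected i j)
  simp only [Pi.sub_apply] at h1
  linarith

theorem exists_isUnitCurrentPotential (hG : G.Connected) (i j : V) :
    ∃ v : V → ℝ, G.IsUnitCurrentPotential i j v := by
  have hsum : ∀ v : V → ℝ, ∑ x, Matrix.mulVec (G.lapMatrix ℝ) v x = 0 := by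
    intro v
    have h1 : dotProduct (fun _ => (1 : ℝ)) (Matrix.mulVec (G.lapMatrix ℝ) v) = 0 := by
      rw [Matrix.dotProduct_mulVec, ← Matrix.mulVec_transpose, (G.isSymm_lapMatrix ℝ).eq,
        G.lapMatrix_mulVec_const_eq_zero, zero_dotProduct]
    simpa [dotProduct] using h1
  have hcard : (Fintype.card V : ℝ) ≠ 0 := by
    have : Nonempty V := ⟨i⟩
    exact_mod_cast Fintype.card_ne_zero
  let T : (V → ℝ) →ₗ[ℝ] (V → ℝ) :=
    { toFun := fun v => Matrix.mulVec (G.lapMatrix ℝ) v + fun _ => ∑ y, v y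
      map_add' := by
        intro v w
        ext x
        simp [Matrix.mulVec_add, Finset.sum_add_distrib]
        ring
      map_smul' := by
        intro c v
        ext x
        simp [Matrix.mulVec_smul, ← Finset.mul_sum, mul_add] }
  have hT : ∀ v, ∑ x, T v x = Fintype.card V * ∑ y, v y := by
    intro v
    simp [T, Finset.sum_add_distrib, hsum v]
  have hL : ∀ v, ∑ y, v y = 0 → T v = Matrix.mulVec (G.lapMatrix ℝ) v := by
    intro v hv
    ext x
    simp [T, hv]
  have hinj : Function.Injective T := by
    rw [injective_iff_map_eq_zero]
    intro v hv
    have h1 := hT v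
    rw [hv] at h1
    have h2 : ∑ y, v y = 0 := by simpa [hcard] using h1.symm
    have h3 := (hL v h2).symm.trans hv
    have h4 := (G.lapMatrix_mulVec_eq_zero_iff_forall_reachable).1 h3
    ext x
    have h5 : ∑ y, v y = Fintype.card V * v x := by
      rw [Finset.sum_congr rfl fun y _ => h4 y x (hG.preconnected y x)]
      simp
    rw [h2] at h5
    simpa [hcard] using h5.symm
  obtain ⟨v, hv⟩ := LinearMap.injective_iff_surjective.1 hinj
    (Pi.single i 1 - Pi.single j 1)
  have h1 := hT v
  rw [hv] at h1
  have h2 : ∑ y, v y = 0 := by simpa [hcard] using h1.symm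
  exact ⟨v, (hL v h2).symm.trans hv⟩

end Resistance

/-- The straight linear 2-tree `G_n`: the graph on the vertices `1, …, n` whose adjacency matrix
has ones exactly on the first and second sub- and superdiagonals. -/
def straightLinearTwoTree (n : ℕ) : SimpleGraph (Finset.Icc 1 n) where
  Adj a b := (b : ℕ) = a + 1 ∨ (b : ℕ) = a + 2 ∨ (a : ℕ) = b + 1 ∨ (a : ℕ) = b + 2
  symm := ⟨fun a b h => by omega⟩
  loopless := ⟨fun a h => by omega⟩

instance (n : ℕ) : DecidableRel (straightLinearTwoTree n).Adj := fun a b =>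
  inferInstanceAs (Decidable ((b : ℕ) = a + 1 ∨ (b : ℕ) = a + 2 ∨ (a : ℕ) = b + 1 ∨
    (a : ℕ) = b + 2))

end SimpleGraph

/-- The Lucas numbers: `L_0 = 2`, `L_1 = 1`, `L_{k+2} = L_k + L_{k+1}`. -/
def lucasNumber : ℕ → ℤ
  | 0 => 2
  | 1 => 1
  | k + 2 => lucasNumber k + lucasNumber (k + 1)

/-- The Fibonacci number `F_p` as a real number, for every integer index `p`
(`F_{-p} = (-1)^(p+1) F_p`). -/
def fibR (p : ℤ) : ℝ := (Int.fib p : ℝ)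

/-! ### Fibonacci numbers with integer index -/

/-! Put d_a = v_a - v_{a+1} and l = j + k. Only the edges {a, a+1}, {a-1, a+1}, {a, a+2} cross the
cut {1..a} | {a+1..n}, so current conservation reads d_{a-1} + 3 d_a + d_{a+1} = 1 for j ≤ a < l and
0 otherwise. The edges missing at the two ends amount to d_0 = -d_1 and d_n = -d_{n-1}. Signed
odd-index Fibonacci numbers solve the homogeneous equation, and the solutions fitting the left and
the right end combine into the Green's function `greenFib`.

By superposition the resistance is the sum of `greenFib` over the square [j, l)²
(`resistanceDistance_straightLinearTwoTree`). Enlarging the square by one index adds an explicit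
Fibonacci term (`sum_greenFib_succ`). Adding these terms gives the first formula; the second has the
same increments, by `closed_form_succ` and hence by Cassini's identity. -/

theorem fibR_zero : fibR 0 = 0 := by simp [fibR]

theorem fibR_one : fibR 1 = 1 := by simp [fibR]

theorem fibR_add_two (p : ℤ) : fibR (p + 2) = fibR p + fibR (p + 1) := by
  simp [fibR, Int.fib_add_two]

theorem fibR_add_add_one (p q : ℤ) :
    fibR (p + q + 1) = fibR p * fibR q + fibR (p + 1) * fibR (q + 1) := by
  have h := Int.fib_add (p + 1) q
  rw [show p + 1 + q = p + q + 1 by ring, add_sub_cancel_right] at h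
  simp [fibR, h]

theorem fibR_natCast_pos {p : ℕ} (hp : 0 < p) : 0 < fibR p := by
  simpa [fibR] using Nat.fib_pos.2 hp

theorem fibR_eq_of_eq_add_two {p q r : ℤ} (hq : q = p + 1) (hr : r = p + 2) :
    fibR r = fibR p + fibR q := by
  rw [hq, hr, fibR_add_two]

/-- Cassini's identity at even indices. -/
theorem fibR_cassini_even (i : ℕ) :
    fibR (2 * i + 1) ^ 2 - fibR (2 * i) * fibR (2 * i + 1) - fibR (2 * i) ^ 2 = 1 := by
  induction i with
  | zero => simp [fibR]
  | succ i ih =>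
    have h1 := fibR_add_two (2 * i)
    have h2 := fibR_eq_of_eq_add_two (p := 2 * i + 1) (q := 2 * i + 2) (r := 2 * i + 3)
      (by ring) (by ring)
    rw [show (2 * ((i + 1 : ℕ) : ℤ)) = 2 * i + 2 by push_cast; ring,
      show (2 * (i : ℤ) + 2 + 1) = 2 * i + 3 by ring, h2, h1]
    linear_combination ih

theorem lucasNumber_eq (k : ℕ) : (lucasNumber k : ℝ) = 2 * fibR (k + 1) - fibR k := by
  induction k using lucasNumber.induct with
  | case1 => simp [lucasNumber, fibR]
  | case2 => norm_num [lucasNumber, fibR]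
  | case3 k h1 h2 =>
    have e1 := fibR_add_two k
    have e2 := fibR_eq_of_eq_add_two (p := k + 1) (q := k + 2) (r := k + 3) (by ring) (by ring)
    push_cast at h2 ⊢
    rw [lucasNumber, Int.cast_add, h1, h2, show (k : ℤ) + 1 + 1 = k + 2 by ring,
      show (k : ℤ) + 2 + 1 = k + 3 by ring]
    linarith

/-- The sequence `(-1)^a F_{2a-1}`. -/
noncomputable def leftFib (a : ℕ) : ℝ := (-1) ^ a * fibR (2 * a - 1)

/-- The sequence `(-1)^a F_{2(n-a)-1}`. -/
noncomputable def rightFib (n a : ℕ) : ℝ := (-1) ^ a * fibR (2 * n - 2 * a - 1)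

/-! ### Homogeneous solutions and Green's function of the cut recurrence -/

theorem fibR_add_four (p : ℤ) : fibR (p + 4) = 3 * fibR (p + 2) - fibR p := by
  have h1 := fibR_add_two p
  have h2 := fibR_eq_of_eq_add_two (p := p + 1) (q := p + 2) (r := p + 3) (by ring) (by ring)
  have h3 := fibR_eq_of_eq_add_two (p := p + 2) (q := p + 3) (r := p + 4) (by ring) (by ring)
  linarith

theorem leftFib_rec (a : ℕ) : leftFib a + 3 * leftFib (a + 1) + leftFib (a + 2) = 0 := by
  have h := fibR_add_four (2 * a - 1)
  simp only [leftFib, Nat.cast_add, Nat.cast_one, Nat.cast_ofNat,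
    show 2 * ((a : ℤ) + 1) - 1 = 2 * a - 1 + 2 by ring,
    show 2 * ((a : ℤ) + 2) - 1 = 2 * a - 1 + 4 by ring, h]
  ring

theorem rightFib_rec (n a : ℕ) :
    rightFib n a + 3 * rightFib n (a + 1) + rightFib n (a + 2) = 0 := by
  have h := fibR_add_four (2 * n - 2 * a - 5)
  simp only [rightFib, Nat.cast_add, Nat.cast_one, Nat.cast_ofNat,
    show 2 * (n : ℤ) - 2 * (a + 1) - 1 = 2 * n - 2 * a - 5 + 2 by ring,
    show 2 * (n : ℤ) - 2 * (a + 2) - 1 = 2 * n - 2 * a - 5 by ring,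
    show 2 * (n : ℤ) - 2 * a - 1 = 2 * n - 2 * a - 5 + 4 by ring, h]
  ring

/-- The outer coefficients of the recurrence are equal, so the Wronskian does not depend on `a`; its
value is the addition formula at 2a + (2n - 2a - 3) + 1. -/
theorem leftFib_rightFib_wronskian (n a : ℕ) :
    leftFib a * rightFib n (a + 1) - leftFib (a + 1) * rightFib n a = fibR (2 * n - 2) := by
  have h := fibR_add_add_one (2 * a) (2 * n - 2 * a - 3)
  have h1 := fibR_eq_of_eq_add_two (p := 2 * a - 1) (q := 2 * a) (r := 2 * a + 1)
    (by ring) (by ring)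
  have h2 := fibR_eq_of_eq_add_two (p := 2 * n - 2 * a - 3) (q := 2 * n - 2 * a - 3 + 1)
    (r := 2 * n - 2 * a - 1) (by ring) (by ring)
  rw [show 2 * (a : ℤ) + (2 * n - 2 * a - 3) + 1 = 2 * n - 2 by ring] at h
  have hs : ((-1 : ℝ) ^ a) ^ 2 = 1 := by rw [← pow_mul, pow_mul', neg_one_sq, one_pow]
  simp only [leftFib, rightFib, Nat.cast_add, Nat.cast_one,
    show 2 * (n : ℤ) - 2 * (a + 1) - 1 = 2 * n - 2 * a - 3 by ring,
    show 2 * ((a : ℤ) + 1) - 1 = 2 * a + 1 by ring, pow_succ]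
  rw [h, h1, h2]
  linear_combination (fibR (2 * a - 1) * fibR (2 * n - 2 * a - 3 + 1) +
    fibR (2 * a) * (fibR (2 * n - 2 * a - 3) + fibR (2 * n - 2 * a - 3 + 1))) * hs

/-- The Green's function of the recurrence `d (a - 1) + 3 d a + d (a + 1)` on `1, …, n - 1` with
the boundary conditions `d 0 = - d 1` and `d n = - d (n - 1)`. -/
noncomputable def greenFib (n a c : ℕ) : ℝ :=
  leftFib (min a c) * rightFib n (max a c) / fibR (2 * n - 2)

theorem greenFib_comm (n a c : ℕ) : greenFib n a c = greenFib n c a := by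
  rw [greenFib, greenFib, min_comm, max_comm]

theorem fibR_two_mul_sub_two_pos {n : ℕ} (hn : 2 ≤ n) : 0 < fibR (2 * n - 2) := by
  obtain ⟨m, rfl⟩ := Nat.exists_eq_add_of_le hn
  have := fibR_natCast_pos (p := 2 * m + 2) (by omega)
  convert this using 2
  push_cast
  ring

/-- Away from the source one factor is fixed and the other solves the homogeneous recurrence. At the
source the switch from one solution to the other leaves exactly the Wronskian, which the denominator
normalises to 1. -/
theorem greenFib_rec {n : ℕ} (hn : 2 ≤ n) (a c : ℕ) :
    greenFib n a c + 3 * greenFib n (a + 1) c + greenFib n (a + 2) c =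
      if a + 1 = c then 1 else 0 := by
  have h0 := (fibR_two_mul_sub_two_pos hn).ne'
  have hA := leftFib_rec a
  have hB := rightFib_rec n a
  have hW := leftFib_rightFib_wronskian n (a + 1)
  simp only [greenFib]
  rcases lt_trichotomy (a + 1) c with h | h | h
  · rw [if_neg h.ne, min_eq_left (by omega), min_eq_left (by omega), min_eq_left (by omega),
      max_eq_right (by omega), max_eq_right (by omega), max_eq_right (by omega)]
    field_simp
    linear_combination rightFib n c * hA
  · subst h
    rw [if_pos rfl, min_eq_left (by omega), min_self, min_eq_right (by omega),
      max_eq_right (by omega), max_self, max_eq_left (by omega)]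
    field_simp
    linear_combination rightFib n (a + 1) * hA + hW
  · rw [if_neg h.ne', min_eq_right (by omega), min_eq_right (by omega), min_eq_right (by omega),
      max_eq_left (by omega), max_eq_left (by omega), max_eq_left (by omega)]
    field_simp
    linear_combination leftFib c * hB

/-- This is F_{-1} = F_1 with the alternating sign; the right end is the mirror image. -/
theorem greenFib_zero_left (n : ℕ) {c : ℕ} (hc : 1 ≤ c) :
    greenFib n 0 c = - greenFib n 1 c := by
  rw [greenFib, greenFib, min_eq_left (by omega), min_eq_left hc, max_eq_right (by omega),
    max_eq_right hc]
  simp [leftFib, fibR]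
  ring

theorem greenFib_succ_self_left {n c : ℕ} (hc : c ≤ n) :
    greenFib (n + 1) (n + 1) c = - greenFib (n + 1) n c := by
  rw [greenFib, greenFib, min_eq_right (by omega), min_eq_right hc, max_eq_left (by omega),
    max_eq_left hc]
  have h1 : 2 * ((n : ℤ) + 1) - 2 * n - 1 = 1 := by ring
  simp [rightFib, fibR, pow_succ, h1]
  ring

/-! ### Currents in the straight linear 2-tree -/

namespace SimpleGraph

theorem lapMatrix_mulVec_eq_sum_ite {V : Type*} [Fintype V] [DecidableEq V] (G : SimpleGraph V)
    [DecidableRel G.Adj] (v : V → ℝ) (x : V) :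
    Matrix.mulVec (G.lapMatrix ℝ) v x = ∑ y, if G.Adj x y then v x - v y else 0 := by
  rw [lapMatrix_mulVec_apply, degree_eq_sum_if_adj, Finset.sum_mul,
    ← Finset.sum_filter, neighborFinset_eq_filter, Finset.sum_filter, Finset.sum_filter,
    ← Finset.sum_sub_distrib]
  refine Finset.sum_congr rfl fun y _ => ?_
  split_ifs <;> simp

theorem sum_straightLinearTwoTree_adj (n : ℕ) (f : ℕ → ℝ) (x : Finset.Icc 1 n) :
    (∑ y, if (straightLinearTwoTree n).Adj x y then f y else 0) =
      (if (x : ℕ) + 1 ≤ n then f (x + 1) else 0) + (if (x : ℕ) + 2 ≤ n then f (x + 2) else 0) +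
      (if 2 ≤ (x : ℕ) then f (x - 1) else 0) + (if 3 ≤ (x : ℕ) then f (x - 2) else 0) := by
  obtain ⟨x, hx⟩ := x
  rw [Finset.mem_Icc] at hx
  have h : ∀ y : Finset.Icc 1 n,
      (if (straightLinearTwoTree n).Adj ⟨x, Finset.mem_Icc.2 hx⟩ y then f y else 0) =
        (fun y : ℕ => (if y = x + 1 then f y else 0) + (if y = x + 2 then f y else 0) +
          (if y = x - 1 ∧ 2 ≤ x then f y else 0) + (if y = x - 2 ∧ 3 ≤ x then f y else 0)) y := by
    rintro ⟨y, hy⟩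
    rw [Finset.mem_Icc] at hy
    refine (if_congr Iff.rfl rfl rfl : _ =
      if y = x + 1 ∨ y = x + 2 ∨ x = y + 1 ∨ x = y + 2 then f y else 0).trans ?_
    dsimp only
    by_cases h1 : y = x + 1
    · rw [if_pos (by omega), if_pos h1, if_neg (by omega), if_neg (by omega), if_neg (by omega)]
      ring
    by_cases h2 : y = x + 2
    · rw [if_pos (by omega), if_neg h1, if_pos h2, if_neg (by omega), if_neg (by omega)]
      ring
    by_cases h3 : x = y + 1
    · rw [if_pos (by omega), if_neg h1, if_neg h2, if_pos (by omega), if_neg (by omega)]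
      ring
    by_cases h4 : x = y + 2
    · rw [if_pos (by omega), if_neg h1, if_neg h2, if_neg (by omega), if_pos (by omega)]
      ring
    · rw [if_neg (by omega), if_neg h1, if_neg h2, if_neg (by omega), if_neg (by omega)]
      ring
  refine (Finset.sum_congr rfl fun y _ => h y).trans ((Finset.sum_coe_sort (Finset.Icc 1 n)
    (fun y : ℕ => (if y = x + 1 then f y else 0) + (if y = x + 2 then f y else 0) +
      (if y = x - 1 ∧ 2 ≤ x then f y else 0) + (if y = x - 2 ∧ 3 ≤ x then f y else 0))).trans ?_)
  simp only [Finset.sum_add_distrib, ite_and, Finset.sum_ite_eq', Finset.mem_Icc]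
  rw [if_pos (show 1 ≤ x + 1 by omega), if_pos (show 1 ≤ x + 2 by omega),
    if_pos (show x - 1 ≤ n by omega), if_pos (show x - 2 ≤ n by omega)]
  simp only [← ite_and]
  rw [if_congr (show 1 ≤ x - 1 ∧ 2 ≤ x ↔ 2 ≤ x by omega) rfl rfl,
    if_congr (show 1 ≤ x - 2 ∧ 3 ≤ x ↔ 3 ≤ x by omega) rfl rfl]

/-- Kirchhoff's law on the cuts `{1, …, a} ∣ {a + 1, …, n}`, in terms of the differences
`d a = v a - v (a + 1)` of potentials of consecutive vertices. -/
theorem isUnitCurrentPotential_straightLinearTwoTree {n j l : ℕ} (hj : 1 ≤ j) (hl : l ≤ n)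
    (hjl : j < l) (v d : ℕ → ℝ) (hvd : ∀ a, v a - v (a + 1) = d a)
    (h0 : d 0 = - d 1) (hn : d n = - d (n - 1))
    (hd : ∀ a, a + 1 < n → d a + 3 * d (a + 1) + d (a + 2) =
      if j ≤ a + 1 ∧ a + 1 < l then 1 else 0) :
    (straightLinearTwoTree n).IsUnitCurrentPotential
      ⟨j, Finset.mem_Icc.2 ⟨hj, by omega⟩⟩ ⟨l, Finset.mem_Icc.2 ⟨by omega, hl⟩⟩
      (fun x => v x) := by
  funext x
  rw [lapMatrix_mulVec_eq_sum_ite]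
  have h := sum_straightLinearTwoTree_adj n (fun y => v x - v y) x
  refine h.trans ?_
  obtain ⟨x, hx⟩ := x
  rw [Finset.mem_Icc] at hx
  simp only [Pi.sub_apply, Pi.single_apply, Subtype.mk.injEq]
  obtain ⟨a, rfl⟩ := Nat.exists_eq_add_of_le' hx.1
  -- Kirchhoff's law at the vertex a + 1 is the difference of the laws for the cuts after a + 1 and
  -- after a.
  have hsrc : (if a + 1 = j then (1 : ℝ) else 0) - (if a + 1 = l then 1 else 0) =
      (if j ≤ a + 1 ∧ a + 1 < l then 1 else 0) - (if j ≤ a ∧ a < l then 1 else 0) := by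
    split_ifs <;> first | omega | norm_num
  rw [hsrc]
  have hv0 := hvd a
  have hv1 := hvd (a + 1)
  have hv2 := hvd (a + 2)
  -- The edge {a, a+2} crosses the cut after a but misses the vertex a + 1. Its current d a + d
  -- (a+1) is therefore added back here, and it cancels against `hright`.
  have hleft : (if 2 ≤ a + 1 then v (a + 1) - v (a + 1 - 1) else 0) +
      (if 3 ≤ a + 1 then v (a + 1) - v (a + 1 - 2) else 0) =
      d a + d (a + 1) - (if j ≤ a ∧ a < l then 1 else 0) := by
    rcases a with _ | _ | a
    · rw [if_neg (by omega), if_neg (by omega), if_neg (by omega), h0]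
      ring
    · have := hd 0 (by omega)
      rw [if_pos (by omega), if_neg (by omega), ← this]
      simp only [Nat.add_sub_cancel, zero_add] at *
      linarith
    · have := hd (a + 1) (by omega)
      have hv3 := hvd (a + 1)
      rw [if_pos (by omega), if_pos (by omega), ← this]
      simp only [add_assoc, Nat.reduceAdd,
        show a + 3 - 2 = a + 1 by omega, show a + 3 - 1 = a + 2 by omega] at *
      linarith
  have hright : (if a + 1 + 1 ≤ n then v (a + 1) - v (a + 1 + 1) else 0) +
      (if a + 1 + 2 ≤ n then v (a + 1) - v (a + 1 + 2) else 0) =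
      (if j ≤ a + 1 ∧ a + 1 < l then 1 else 0) - d a - d (a + 1) := by
    rcases (show a + 1 = n ∨ a + 2 = n ∨ a + 3 ≤ n by omega) with h | h | h
    · rw [if_neg (by omega), if_neg (by omega), if_neg (by omega)]
      rw [← h, Nat.add_sub_cancel] at hn
      rw [hn]
      ring
    · have := hd a (by omega)
      rw [if_pos (by omega), if_neg (by omega), ← this]
      rw [← h, show a + 2 - 1 = a + 1 by omega] at hn
      linarith
    · have := hd a (by omega)
      rw [if_pos (by omega), if_pos (by omega), ← this]
      simp only [add_assoc, Nat.reduceAdd] at *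
      linarith
  linarith

theorem straightLinearTwoTree_connected {n : ℕ} (hn : 1 ≤ n) :
    (straightLinearTwoTree n).Connected := by
  have h : ∀ a, ∀ ha : a ∈ Finset.Icc 1 n, (straightLinearTwoTree n).Reachable
      ⟨1, Finset.mem_Icc.2 ⟨le_rfl, hn⟩⟩ ⟨a, ha⟩ := by
    intro a
    induction a with
    | zero => simp
    | succ a ih =>
      intro ha
      rw [Finset.mem_Icc] at ha
      rcases Nat.eq_zero_or_pos a with rfl | h0
      · exact Reachable.refl _
      · refine (ih (Finset.mem_Icc.2 ⟨h0, by omega⟩)).trans (Adj.reachable ?_)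
        exact Or.inl rfl
  have : Nonempty (Finset.Icc 1 n) := ⟨⟨1, Finset.mem_Icc.2 ⟨le_rfl, hn⟩⟩⟩
  exact ⟨fun x y => (h x x.2).symm.trans (h y y.2)⟩

theorem resistanceDistance_straightLinearTwoTree {n j l : ℕ} (hj : 1 ≤ j) (hl : l ≤ n)
    (hjl : j < l) :
    (straightLinearTwoTree n).resistanceDistance
      ⟨j, Finset.mem_Icc.2 ⟨hj, by omega⟩⟩ ⟨l, Finset.mem_Icc.2 ⟨by omega, hl⟩⟩ =
      ∑ a ∈ Finset.Ico j l, ∑ c ∈ Finset.Ico j l, greenFib n a c := by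
  set d : ℕ → ℝ := fun a => ∑ c ∈ Finset.Ico j l, greenFib n a c with hd
  have hv := isUnitCurrentPotential_straightLinearTwoTree hj hl hjl
    (fun x => - ∑ a ∈ Finset.range x, d a) d
    (fun a => by simp only [Finset.sum_range_succ]; ring)
    (by
      rw [hd]
      simp only [← Finset.sum_neg_distrib]
      refine Finset.sum_congr rfl fun c hc => greenFib_zero_left n ?_
      rw [Finset.mem_Ico] at hc
      omega)
    (by
      obtain ⟨n, rfl⟩ : ∃ k, n = k + 1 := ⟨n - 1, by omega⟩
      rw [hd]
      simp only [← Finset.sum_neg_distrib]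
      refine Finset.sum_congr rfl fun c hc => greenFib_succ_self_left ?_
      rw [Finset.mem_Ico] at hc
      omega)
    (fun a _ => by
      simp only [hd, Finset.mul_sum, ← Finset.sum_add_distrib]
      rw [Finset.sum_congr rfl fun c _ => greenFib_rec (show 2 ≤ n by omega) a c,
        Finset.sum_ite_eq]
      simp only [Finset.mem_Ico])
  rw [resistanceDistance_eq _ (straightLinearTwoTree_connected (by omega)) hv,
    Finset.sum_Ico_eq_sub _ hjl.le]
  ring

end SimpleGraph

/-! ### Evaluation of the sums -/

/-- Up to a common factor this is the border gained when the index j + k joins the square: the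
corner once, the row and the column equally by symmetry. -/
theorem leftFib_add_two_mul_sum {j : ℕ} (k : ℕ) :
    leftFib (j + k) + 2 * ∑ a ∈ Finset.Ico j (j + k), leftFib a =
      (-1) ^ (j + k) * (fibR (k + 1) * fibR (k + 2 * j - 1) - fibR k * fibR (k + 2 * j - 2)) := by
  induction k with
  | zero => simp [leftFib, fibR_one, fibR_zero]
  | succ k ih =>
    rw [← add_assoc, Finset.sum_Ico_succ_top (by omega)]
    have h1 := fibR_add_add_one (k + 1) (k + 2 * j - 2)
    have h2 := fibR_eq_of_eq_add_two (p := 2 * (j + k) - 1) (q := 2 * (j + k))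
      (r := 2 * (j + k) + 1) (by ring) (by ring)
    have h3 := fibR_eq_of_eq_add_two (p := k) (q := k + 1) (r := k + 2) (by ring) (by ring)
    have h4 := fibR_eq_of_eq_add_two (p := k + 2 * j - 2) (q := k + 2 * j - 1)
      (r := k + 2 * j) (by ring) (by ring)
    simp only [leftFib, Nat.cast_add, Nat.cast_one] at ih ⊢
    simp only [show (k : ℤ) + 1 + (k + 2 * j - 2) + 1 = 2 * (j + k) by ring,
      show (k : ℤ) + 1 + 1 = k + 2 by ring,
      show (k : ℤ) + 1 + 2 * j - 1 = k + 2 * j by ring,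
      show (k : ℤ) + 1 + 2 * j - 2 = k + 2 * j - 1 by ring,
      show (k : ℤ) + 2 * j - 2 + 1 = k + 2 * j - 1 by ring,
      show 2 * ((j : ℤ) + k + 1) - 1 = 2 * (j + k) + 1 by ring] at h1 h2 h3 h4 ⊢
    rw [h2, h1, h3, h4, pow_succ]
    linear_combination ih

theorem sum_greenFib_succ (n j k : ℕ) :
    ∑ a ∈ Finset.Ico j (j + k + 1), ∑ c ∈ Finset.Ico j (j + k + 1), greenFib n a c =
      ∑ a ∈ Finset.Ico j (j + k), ∑ c ∈ Finset.Ico j (j + k), greenFib n a c +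
      (fibR (k + 1) * fibR (k + 2 * j - 1) - fibR k * fibR (k + 2 * j - 2)) *
        fibR (2 * n - 2 * (j + k) - 1) / fibR (2 * n - 2) := by
  have h1 : ∀ a ∈ Finset.Ico j (j + k), greenFib n a (j + k) =
      leftFib a * (rightFib n (j + k) / fibR (2 * n - 2)) := by
    intro a ha
    rw [Finset.mem_Ico] at ha
    rw [greenFib, min_eq_left (by omega), max_eq_right (by omega), mul_div_assoc]
  have h2 : greenFib n (j + k) (j + k) =
      leftFib (j + k) * (rightFib n (j + k) / fibR (2 * n - 2)) := by
    rw [greenFib, min_self, max_self, mul_div_assoc]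
  simp only [Finset.sum_Ico_succ_top (show j ≤ j + k by omega), Finset.sum_add_distrib]
  rw [Finset.sum_congr rfl fun c _ => greenFib_comm n (j + k) c, Finset.sum_congr rfl h1, h2,
    ← Finset.sum_mul]
  have hs : ((-1 : ℝ) ^ (j + k)) ^ 2 = 1 := by rw [← pow_mul, pow_mul', neg_one_sq, one_pow]
  have h3 := leftFib_add_two_mul_sum (j := j) k
  have h4 : rightFib n (j + k) = (-1) ^ (j + k) * fibR (2 * n - 2 * (j + k) - 1) := by
    simp [rightFib]
  linear_combination rightFib n (j + k) / fibR (2 * n - 2) * h3 +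
    (-1) ^ (j + k) * (fibR (k + 1) * fibR (k + 2 * j - 1) - fibR k * fibR (k + 2 * j - 2)) /
      fibR (2 * n - 2) * h4 +
    (fibR (k + 1) * fibR (k + 2 * j - 1) - fibR k * fibR (k + 2 * j - 2)) *
        fibR (2 * n - 2 * (j + k) - 1) / fibR (2 * n - 2) * hs

theorem sum_greenFib_eq_sum (m j k : ℕ) :
    ∑ a ∈ Finset.Ico j (j + k), ∑ c ∈ Finset.Ico j (j + k), greenFib (m + 2) a c =
      (∑ i ∈ Finset.Icc 1 k,
          (fibR i * fibR (i + 2 * j - 2) - fibR (i - 1) * fibR (i + 2 * j - 3)) *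
            fibR (2 * m - 2 * i - 2 * j + 5)) / fibR (2 * m + 2) := by
  induction k with
  | zero => simp
  | succ k ih =>
    rw [← add_assoc, sum_greenFib_succ, ih, Finset.sum_Icc_succ_top (by omega), add_div]
    push_cast
    simp only [show (k : ℤ) + 1 + 2 * j - 2 = k + 2 * j - 1 by ring,
      show (k : ℤ) + 1 + 2 * j - 3 = k + 2 * j - 2 by ring, add_sub_cancel_right,
      show 2 * (m : ℤ) - 2 * (k + 1) - 2 * j + 5 = 2 * (m + 2) - 2 * (j + k) - 1 by ring,
      show 2 * ((m : ℤ) + 2) - 2 = 2 * m + 2 by ring]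

/-- With t = m - 2i - k, the addition formula turns both sides into polynomials in Fibonacci numbers
near k, t and 2i; they differ by a multiple of Cassini's identity at 2i. -/
theorem closed_form_succ (m i k : ℕ) :
    fibR (k + 1) ^ 2 * fibR (m - 2 * i - k) ^ 2 - fibR k ^ 2 * fibR (m - 2 * i - k + 1) ^ 2 +
      fibR (k + 1) ^ 2 * fibR (m - k + 1) ^ 2 - fibR k ^ 2 * fibR (m - k) ^ 2 =
    (fibR (k + 1) * fibR (k + 2 * i + 1) - fibR k * fibR (k + 2 * i)) *
      fibR (2 * (m - k) - 2 * i + 1) := by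
  obtain ⟨t, ht⟩ : ∃ t : ℤ, t = m - 2 * i - k := ⟨_, rfl⟩
  have hC := fibR_cassini_even i
  have h1 := fibR_add_add_one t (2 * i)
  have h2 := fibR_add_add_one t (2 * i - 1)
  have h3 := fibR_add_add_one k (2 * i)
  have h4 := fibR_add_add_one k (2 * i - 1)
  have h5 := fibR_add_add_one t (t + 2 * i)
  have h6 := fibR_eq_of_eq_add_two (p := 2 * i - 1) (q := 2 * i) (r := 2 * i + 1)
    (by ring) (by ring)
  rw [show (m : ℤ) - k = t + 2 * i by rw [ht]; ring, ← ht,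
    show 2 * (t + 2 * i) - 2 * i + 1 = t + (t + 2 * i) + 1 by ring, h5, h1, h3,
    show t + 2 * i = t + (2 * i - 1) + 1 by ring, h2,
    show (k : ℤ) + 2 * i = k + (2 * i - 1) + 1 by ring, h4,
    show 2 * (i : ℤ) - 1 + 1 = 2 * i by ring]
  rw [h6] at hC ⊢
  linear_combination (-(fibR (k + 1) ^ 2 * fibR t ^ 2) + fibR k ^ 2 * fibR (t + 1) ^ 2) * hC

theorem sum_greenFib_eq_closed_form (m i k : ℕ) :
    ∑ a ∈ Finset.Ico (i + 1) (i + 1 + k), ∑ c ∈ Finset.Ico (i + 1) (i + 1 + k),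
        greenFib (m + 2) a c =
      (fibR (m + 1) ^ 2 + fibR k ^ 2 * fibR (m - 2 * (i + 1 : ℕ) - k + 3) ^ 2 +
          fibR (m + 1) / 5 *
            (fibR (m - k) * (k * lucasNumber k - fibR k) +
              fibR (m - k + 1) * ((k - 5) * fibR (k + 1) + (2 * k + 2) * fibR k))) /
        fibR (2 * m + 2) := by
  simp only [lucasNumber_eq]
  induction k with
  | zero =>
    simp [fibR_zero, fibR_one]
    ring
  | succ k ih =>
    rw [← add_assoc, sum_greenFib_succ, ih]
    have h1 := closed_form_succ m i k
    have h2 := fibR_add_add_one k (m - k)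
    have h3 := fibR_add_two k
    have h4 := fibR_eq_of_eq_add_two (p := m - k - 1) (q := m - k) (r := m - k + 1)
      (by ring) (by ring)
    push_cast
    simp only [show (k : ℤ) + 2 * (i + 1) - 1 = k + 2 * i + 1 by ring,
      show (k : ℤ) + 2 * (i + 1) - 2 = k + 2 * i by ring,
      show 2 * ((m : ℤ) + 2) - 2 * (i + 1 + k) - 1 = 2 * (m - k) - 2 * i + 1 by ring,
      show 2 * ((m : ℤ) + 2) - 2 = 2 * m + 2 by ring,
      show (m : ℤ) - 2 * (i + 1) - k + 3 = m - 2 * i - k + 1 by ring,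
      show (m : ℤ) - 2 * (i + 1) - (k + 1) + 3 = m - 2 * i - k by ring,
      show (m : ℤ) - (k + 1) = m - k - 1 by ring,
      show (m : ℤ) - k - 1 + 1 = m - k by ring,
      show (k : ℤ) + (m - k) + 1 = m + 1 by ring,
      show (k : ℤ) + 1 + 1 = k + 2 by ring] at h1 h2 ⊢
    -- By `h2`, F_{m+1} = F_k F_{m-k} + F_{k+1} F_{m-k+1} divides the last two squares of `h1` as a
    -- difference of squares. The cofactor F_{k+1} F_{m-k+1} - F_k F_{m-k} is one fifth of the
    -- increment of the bracket.
    rw [← add_div, ← h1, h2, h3]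
    congr 1
    rw [show fibR (m - k - 1) = fibR (m - k + 1) - fibR (m - k) by linarith]
    ring

theorem mainTheorem1 (n m j k : ℕ) (hn : n = m + 2) (hj : 1 ≤ j) (hk : 1 ≤ k) (hjk : j + k ≤ n) :
    (SimpleGraph.straightLinearTwoTree n).resistanceDistance
        ⟨j, Finset.mem_Icc.2 ⟨hj, by omega⟩⟩ ⟨j + k, Finset.mem_Icc.2 ⟨by omega, hjk⟩⟩ =
      (∑ i ∈ Finset.Icc 1 k,
          (fibR i * fibR (i + 2 * j - 2) - fibR (i - 1) * fibR (i + 2 * j - 3)) *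
            fibR (2 * m - 2 * i - 2 * j + 5)) / fibR (2 * m + 2) ∧
    (SimpleGraph.straightLinearTwoTree n).resistanceDistance
        ⟨j, Finset.mem_Icc.2 ⟨hj, by omega⟩⟩ ⟨j + k, Finset.mem_Icc.2 ⟨by omega, hjk⟩⟩ =
      (fibR (m + 1) ^ 2 + fibR k ^ 2 * fibR (m - 2 * j - k + 3) ^ 2 +
          fibR (m + 1) / 5 *
            (fibR (m - k) * (k * lucasNumber k - fibR k) +
              fibR (m - k + 1) * ((k - 5) * fibR (k + 1) + (2 * k + 2) * fibR k))) /
        fibR (2 * m + 2) := by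
  subst hn
  rw [SimpleGraph.resistanceDistance_straightLinearTwoTree hj hjk (by omega)]
  refine ⟨sum_greenFib_eq_sum m j k, ?_⟩
  obtain ⟨i, rfl⟩ := Nat.exists_eq_add_of_le' hj
  exact sum_greenFib_eq_closed_form m i k
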